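/- Let $n\ge 0$ buyers arrive in order with independent values $V_i\sim D_i$, where each $D_i$ is a probability distribution on $[0,1]$; write $\mathbf D=D_1\times\cdots\times D_n$. A posted-price policy is a vector $\pi\in[0,1]^n$; the first buyer $i$ (if any) with $V_i\ge\pi_i$ wins the item. Let $\pi(\mathbf D)$ be the expected value of the winner (counted as $0$ if the item is not sold). A policy $\pi\in[0,1]^n$ is an $\varepsilon$-approximation for $\mathbf D$ if $\pi(\mathbf D)\ge\sup_{\pi'\in[0,1]^n}\pi'(\mathbf D)-\varepsilon$. The sample complexity (for $n,\varepsilon,\delta$) is the least number $T$ for which some, possibly randomized, learning algorithm, given $T$ i.i.d. samples from $\mathbf D$, returns an $\varepsilon$-approximation with probability at least $1-\delta$ under every product distribution $\mathbf D$ on $[0,1]^n$. **Theorem.** The sample complexity is $O(\log^2(1/\delta)/\varepsilon^2)$, independently of $n$: for every $\delta_0<1$ there is a constant $C$ such that, for all $n$, all $\varepsilon\in(0,1)$ and all $\delta\in(0,\delta_0]$, it is at most $C\log^2(1/\delta)/\varepsilon^2$. More precisely, given samples $\mathbf V^{(1)},\dots,\mathbf V^{(T)}$, set $\hat r_{n+1}=0$,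 $\hat r_i=\frac1T\sum_{t=1}^T\max\{\hat r_{i+1},V^{(t)}_i\}$, and $\hat\pi_i=\hat r_{i+1}$. For $T\ge1$ and samples in $[0,1]^n$, $\hat\pi$ is a policy in $[0,1]^n$ that is optimal for the product empirical distribution, whose $i$-th marginal is uniform on $V^{(1)}_i,\dots,V^{(T)}_i$. Moreover, for all $n$, all $\varepsilon,\delta\in(0,1)$, every product distribution $\mathbf D$ on $[0,1]^n$ and every integer $T\ge\bigl(5\ln(2e/\delta)/\varepsilon\bigr)^2$, $\hat\pi$ is an $\varepsilon$-approximation for $\mathbf D$ with probability at least $1-\delta$ over $T$ i.i.d. samples from $\mathbf D$. -/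

import Mathlib

open MeasureTheory ProbabilityTheory
open scoped ENNReal

noncomputable section

namespace PostedPricing

/-- The full policy class `[0,1]^n` of posted price vectors. -/
def policies (n : ℕ) : Set (Fin n → ℝ) := {π | ∀ i, π i ∈ Set.Icc (0 : ℝ) 1}

/-- Buyer `i` wins: she is the first buyer whose value is at least the price offered to her. -/
def Wins {n : ℕ} (π v : Fin n → ℝ) (i : Fin n) : Prop :=
  π i ≤ v i ∧ ∀ j < i, v j < π j

open Classical in
/-- The welfare of the prices `π` under the values `v`: the value of the winner, and `0` if the
item is not sold (at most one buyer wins, so the sum has at most one nonzero term). -/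
def welfare {n : ℕ} (π v : Fin n → ℝ) : ℝ :=
  ∑ i, if Wins π v i then v i else 0

/-- The expected welfare of the prices `π` when the vector of values has law `μ`. -/
def expectedWelfare {n : ℕ} (π : Fin n → ℝ) (μ : Measure (Fin n → ℝ)) : ℝ :=
  ∫ v, welfare π v ∂μ

/-- The best expected welfare of a posted price policy that knows the law `μ` of the values. -/
def optWelfare {n : ℕ} (μ : Measure (Fin n → ℝ)) : ℝ :=
  sSup ((fun π => expectedWelfare π μ) '' policies n)

/-- `π` is a posted price policy that is optimal for `μ` up to the additive error `ε`. -/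
def IsApprox {n : ℕ} (μ : Measure (Fin n → ℝ)) (ε : ℝ) (π : Fin n → ℝ) : Prop :=
  π ∈ policies n ∧ optWelfare μ - ε ≤ expectedWelfare π μ

/-- The law of `T` independent samples from the product distribution with marginals `D i`;
`S t i` is the value of buyer `i` in sample `t`. -/
def sampleLaw {n : ℕ} (D : Fin n → Measure ℝ) (T : ℕ) : Measure (Fin T → Fin n → ℝ) :=
  Measure.pi fun _ => Measure.pi D

/-- The reward of the dynamic program on the product distribution with marginals `D i`:
`r_{n+1} = 0`, `r_i = E[max (r_{i+1}, V_i)]`; the value is the reward before the first buyer. -/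
def dpReward : {n : ℕ} → (Fin n → Measure ℝ) → ℝ
  | 0, _ => 0
  | _ + 1, D => ∫ x, max (dpReward (Fin.tail D)) x ∂(D 0)

/-- The prices of the dynamic program: buyer `i` is offered the reward `r_{i+1}` of the dynamic
program on the buyers after her. -/
def dpPolicy : {n : ℕ} → (Fin n → Measure ℝ) → (Fin n → ℝ)
  | 0, _ => Fin.elim0
  | _ + 1, D => Fin.cons (dpReward (Fin.tail D)) (dpPolicy (Fin.tail D))

/-- The empirical marginals: for buyer `i`, the uniform distribution on her `T` sampled values. -/
def empirical {n T : ℕ} (S : Fin T → Fin n → ℝ) (i : Fin n) : Measure ℝ :=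
  (T : ℝ≥0∞)⁻¹ • ∑ t, Measure.dirac (S t i)

/-- The (possibly randomized) learning algorithm `A`, which maps `T` samples to a random price
vector, returns an `ε`-approximation with probability at least `1 - δ` over the samples and its
own randomness, under every product distribution on `[0,1]^n`. -/
def Learns {n T : ℕ} (A : Kernel (Fin T → Fin n → ℝ) (Fin n → ℝ)) (ε δ : ℝ) : Prop :=
  ∀ (D : Fin n → Measure ℝ) [∀ i, IsProbabilityMeasure (D i)],
    (∀ i, ∀ᵐ x ∂(D i), x ∈ Set.Icc (0 : ℝ) 1) →
    ((sampleLaw D T).bind A) {π | ¬ IsApprox (Measure.pi D) ε π} ≤ ENNReal.ofReal δ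

/-- The sample complexity of welfare maximization for product distributions on `[0,1]^n`: the
least number of samples with which some learning algorithm succeeds (`⊤` if there is none). -/
def sampleComplexity (n : ℕ) (ε δ : ℝ) : ℕ∞ :=
  sInf {m : ℕ∞ | ∃ T : ℕ, m = T ∧
    ∃ A : Kernel (Fin T → Fin n → ℝ) (Fin n → ℝ), IsMarkovKernel A ∧ Learns A ε δ}

end PostedPricing

end

open PostedPricing

namespace PostedPricing

/-! By backward induction the optimum equals the dynamic-program reward `r`, so it suffices to
compare `r` and the true welfare `W` of the learned prices with the empirical reward `r̂`. Read from
the last buyer to the first, `r̂` is a process whose new randomness at each buyer is independent of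
the later buyers. Doob's decomposition writes it as a martingale `M` (`deviation`) plus an
increasing compensator `C`.

If every partial `|M|` is at most `a`, errors do not accumulate over the buyers: `r - r̂ ≤ a - M`
and `r̂ - W ≤ a + M`, hence `r - W ≤ 2a` (`dpReward_sub_le`, `dpReward_empirical_sub_le`).

Independence of `n` comes from a self-bounding variance. The excess of `max r̂ V` over `r̂` lies in
`[0,1]`, so its variance is controlled by its mean, which is the increment of `C`; and `C = r̂ - M ≤
1 - M` however many buyers there are. Thus `exp (± √T M - C)` are supermartingales started at 1
(`lintegral_stoppedExpDeviation_le`). Stopping them at `2/δ` and applying Markov's inequality bounds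
all partial `|M|` at once, by order `log (1/δ) / √T`. -/

instance isProbabilityMeasure_tail {n : ℕ} (D : Fin (n + 1) → Measure ℝ)
    [h : ∀ i, IsProbabilityMeasure (D i)] (i : Fin n) : IsProbabilityMeasure (Fin.tail D i) :=
  h i.succ

/-! ### Welfare of posted prices and optimality of the dynamic program. -/

theorem welfare_succ {n : ℕ} (π v : Fin (n + 1) → ℝ) :
    welfare π v = if π 0 ≤ v 0 then v 0 else welfare (Fin.tail π) (Fin.tail v) := by
  classical
  have h0 : Wins π v 0 ↔ π 0 ≤ v 0 := by simp [Wins]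
  have hs : ∀ i : Fin n, Wins π v i.succ ↔
      v 0 < π 0 ∧ Wins (Fin.tail π) (Fin.tail v) i := by
    intro i
    simp only [Wins, Fin.tail, Fin.forall_fin_succ, Fin.succ_pos, Fin.succ_lt_succ_iff, true_imp_iff]
    tauto
  unfold welfare
  rw [Fin.sum_univ_succ]
  by_cases h : π 0 ≤ v 0
  · simp [h0, hs, h, h.not_gt]
  · simp [h0, hs, h, not_le.1 h, Fin.tail]

theorem measurable_welfare {n : ℕ} :
    Measurable fun q : (Fin n → ℝ) × (Fin n → ℝ) => welfare q.1 q.2 := by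
  classical
  unfold welfare
  refine Finset.measurable_sum _ fun i _ => Measurable.ite ?_ (by fun_prop) measurable_const
  simp only [Wins, Set.ofPred_and, Set.ofPred_forall]
  refine (measurableSet_le (by fun_prop) (by fun_prop)).inter ?_
  refine MeasurableSet.iInter fun j => MeasurableSet.iInter fun _ => ?_
  exact measurableSet_lt (by fun_prop) (by fun_prop)

theorem measurable_welfare_right {n : ℕ} (π : Fin n → ℝ) : Measurable (welfare π) :=
  measurable_welfare.comp measurable_prodMk_left

theorem welfare_mem_Icc {n : ℕ} (π v : Fin n → ℝ) (hv : ∀ i, v i ∈ Set.Icc (0 : ℝ) 1) :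
    welfare π v ∈ Set.Icc (0 : ℝ) 1 := by
  induction n with
  | zero => simp [welfare]
  | succ n ih =>
    rw [welfare_succ]
    split_ifs
    · exact hv 0
    · exact ih _ _ fun i => hv i.succ

theorem ae_pi_mem {ι : Type*} [Fintype ι] {α : ι → Type*} [∀ i, MeasurableSpace (α i)]
    (μ : ∀ i, Measure (α i)) [∀ i, IsProbabilityMeasure (μ i)] {p : ∀ i, α i → Prop}
    (h : ∀ i, ∀ᵐ x ∂(μ i), p i x) : ∀ᵐ v ∂(Measure.pi μ), ∀ i, p i (v i) :=
  ae_all_iff.2 fun i => (measurePreserving_eval μ i).quasiMeasurePreserving.ae (h i)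

theorem integrable_welfare {n : ℕ} (D : Fin n → Measure ℝ) [∀ i, IsProbabilityMeasure (D i)]
    (hD : ∀ i, ∀ᵐ x ∂(D i), x ∈ Set.Icc (0 : ℝ) 1) (π : Fin n → ℝ) :
    Integrable (welfare π) (Measure.pi D) :=
  Integrable.of_mem_Icc 0 1 (measurable_welfare_right π).aemeasurable
    ((ae_pi_mem D hD).mono fun v hv => welfare_mem_Icc π v hv)

/-- Conditioning the expected welfare on the value of the first buyer. -/
theorem expectedWelfare_succ {n : ℕ} (D : Fin (n + 1) → Measure ℝ)
    [∀ i, IsProbabilityMeasure (D i)] (hD : ∀ i, ∀ᵐ x ∂(D i), x ∈ Set.Icc (0 : ℝ) 1)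
    (π : Fin (n + 1) → ℝ) :
    expectedWelfare π (Measure.pi D) =
      ∫ x, (if π 0 ≤ x then x else
        expectedWelfare (Fin.tail π) (Measure.pi (Fin.tail D))) ∂(D 0) := by
  let g : ℝ × (Fin n → ℝ) → ℝ := fun q => if π 0 ≤ q.1 then q.1 else welfare (Fin.tail π) q.2
  have mp := measurePreserving_piFinSuccAbove D 0
  have hg : ∀ v, g (MeasurableEquiv.piFinSuccAbove (fun _ => ℝ) 0 v) = welfare π v := by
    intro v
    rw [welfare_succ]
    rfl
  have hi : Integrable g ((D 0).prod (Measure.pi (Fin.tail D))) := by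
    refine (mp.integrable_comp_emb (MeasurableEquiv.measurableEmbedding _)).1 ?_
    exact (integrable_welfare D hD π).congr (Filter.Eventually.of_forall fun v => (hg v).symm)
  calc expectedWelfare π (Measure.pi D)
      = ∫ v, g (MeasurableEquiv.piFinSuccAbove (fun _ => ℝ) 0 v) ∂(Measure.pi D) := by
        simp_rw [hg]; rfl
    _ = ∫ q, g q ∂((D 0).prod (Measure.pi (Fin.tail D))) := mp.integral_comp' g
    _ = _ := by
      rw [integral_prod _ hi]
      refine integral_congr_ae (Filter.Eventually.of_forall fun x => ?_)
      by_cases h : π 0 ≤ x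
      · simp [g, h]
      · simp [g, h, expectedWelfare]

theorem dpReward_nonneg {n : ℕ} (D : Fin n → Measure ℝ) : 0 ≤ dpReward D := by
  induction n with
  | zero => simp [dpReward]
  | succ n ih => exact integral_nonneg fun x => (ih (Fin.tail D)).trans (le_max_left _ _)

theorem integrable_max {μ : Measure ℝ} [IsProbabilityMeasure μ]
    (hμ : ∀ᵐ x ∂μ, x ∈ Set.Icc (0 : ℝ) 1) (r : ℝ) : Integrable (fun x => max r x) μ :=
  Integrable.of_mem_Icc (max r 0) (max r 1) (by fun_prop)
    (hμ.mono fun _ hx => ⟨max_le_max le_rfl hx.1, max_le_max le_rfl hx.2⟩)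

theorem integrable_ite {μ : Measure ℝ} [IsProbabilityMeasure μ]
    (hμ : ∀ᵐ x ∂μ, x ∈ Set.Icc (0 : ℝ) 1) (p w : ℝ) :
    Integrable (fun x => if p ≤ x then x else w) μ := by
  refine Integrable.of_mem_Icc (min 0 w) (max 1 w)
    (Measurable.ite measurableSet_Ici measurable_id measurable_const).aemeasurable
    (hμ.mono fun x hx => ?_)
  split_ifs
  · exact ⟨(min_le_left _ _).trans hx.1, hx.2.trans (le_max_left _ _)⟩
  · exact ⟨min_le_right _ _, le_max_right _ _⟩

theorem dpReward_le_one {n : ℕ} (D : Fin n → Measure ℝ) [∀ i, IsProbabilityMeasure (D i)]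
    (hD : ∀ i, ∀ᵐ x ∂(D i), x ∈ Set.Icc (0 : ℝ) 1) : dpReward D ≤ 1 := by
  induction n with
  | zero => simp [dpReward]
  | succ n ih =>
    refine (integral_mono_ae (integrable_max (hD 0) _) (integrable_const 1)
      ((hD 0).mono fun x hx => max_le (ih (Fin.tail D) fun i => hD i.succ) hx.2)).trans ?_
    simp

theorem dpPolicy_mem_policies {n : ℕ} (D : Fin n → Measure ℝ) [∀ i, IsProbabilityMeasure (D i)]
    (hD : ∀ i, ∀ᵐ x ∂(D i), x ∈ Set.Icc (0 : ℝ) 1) : dpPolicy D ∈ policies n := by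
  induction n with
  | zero => exact fun i => i.elim0
  | succ n ih =>
    intro i
    refine Fin.cases ?_ (fun i => ?_) i
    · exact ⟨dpReward_nonneg _, dpReward_le_one (Fin.tail D) fun i => hD i.succ⟩
    · exact ih (Fin.tail D) (fun i => hD i.succ) i

/-- Whether the first buyer wins or not, the payoff is at most the larger of her value and the best
continuation. -/
theorem expectedWelfare_le_dpReward {n : ℕ} (D : Fin n → Measure ℝ)
    [∀ i, IsProbabilityMeasure (D i)] (hD : ∀ i, ∀ᵐ x ∂(D i), x ∈ Set.Icc (0 : ℝ) 1)
    (π : Fin n → ℝ) : expectedWelfare π (Measure.pi D) ≤ dpReward D := by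
  induction n with
  | zero => simp [dpReward, expectedWelfare, welfare]
  | succ n ih =>
    rw [expectedWelfare_succ D hD]
    refine integral_mono (integrable_ite (hD 0) _ _) (integrable_max (hD 0) _) fun x => ?_
    dsimp only
    split_ifs
    · exact le_max_right _ _
    · exact (ih (Fin.tail D) (fun i => hD i.succ) _).trans (le_max_left _ _)

theorem expectedWelfare_dpPolicy {n : ℕ} (D : Fin n → Measure ℝ)
    [∀ i, IsProbabilityMeasure (D i)] (hD : ∀ i, ∀ᵐ x ∂(D i), x ∈ Set.Icc (0 : ℝ) 1) :
    expectedWelfare (dpPolicy D) (Measure.pi D) = dpReward D := by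
  induction n with
  | zero => simp [dpReward, expectedWelfare, welfare]
  | succ n ih =>
    rw [expectedWelfare_succ D hD]
    refine integral_congr_ae (Filter.Eventually.of_forall fun x => ?_)
    have h := ih (Fin.tail D) fun i => hD i.succ
    simp only [dpPolicy, Fin.cons_zero, Fin.tail_cons, h]
    split_ifs with hx
    · exact (max_eq_right hx).symm
    · exact (max_eq_left (not_le.1 hx).le).symm

theorem optWelfare_pi {n : ℕ} (D : Fin n → Measure ℝ) [∀ i, IsProbabilityMeasure (D i)]
    (hD : ∀ i, ∀ᵐ x ∂(D i), x ∈ Set.Icc (0 : ℝ) 1) : optWelfare (Measure.pi D) = dpReward D := by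
  refine IsGreatest.csSup_eq ⟨⟨dpPolicy D, dpPolicy_mem_policies D hD,
    expectedWelfare_dpPolicy D hD⟩, ?_⟩
  rintro _ ⟨π, -, rfl⟩
  exact expectedWelfare_le_dpReward D hD π

/-! ### Empirical marginals. -/

theorem isProbabilityMeasure_empirical {n T : ℕ} (hT : 0 < T) (S : Fin T → Fin n → ℝ)
    (i : Fin n) : IsProbabilityMeasure (empirical S i) := by
  constructor
  simp only [empirical, Measure.smul_apply, Measure.finsetSum_apply, measure_univ, smul_eq_mul,
    Finset.sum_const, Finset.card_univ, Fintype.card_fin, nsmul_eq_mul, mul_one]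
  exact ENNReal.inv_mul_cancel (by simpa using hT.ne') (by simp)

theorem ae_empirical {n T : ℕ} {S : Fin T → Fin n → ℝ} {i : Fin n} {p : ℝ → Prop}
    (hp : MeasurableSet {x | p x}) (h : ∀ t, p (S t i)) : ∀ᵐ x ∂(empirical S i), p x := by
  refine Measure.ae_smul_measure ?_ _
  rw [ae_iff, Measure.finsetSum_apply]
  refine Finset.sum_eq_zero fun t _ => ?_
  rw [← ae_iff, ae_dirac_iff hp]
  exact h t

theorem integral_empirical {n T : ℕ} (S : Fin T → Fin n → ℝ) (i : Fin n) {f : ℝ → ℝ} :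
    ∫ x, f x ∂(empirical S i) = (T : ℝ)⁻¹ * ∑ t, f (S t i) := by
  rw [empirical, integral_smul_measure, integral_finsetSum_measure]
  · simp
  · intro t _
    exact integrable_dirac (by simp)

/-! ### Doob decomposition of the empirical rewards. -/

/-- The compensator of the empirical rewards, which run from the last buyer to the first one:
the sum over the buyers of `E[max (r̂_{i+1}, V_i)] - r̂_{i+1}`. -/
noncomputable def compensator {T : ℕ} : {n : ℕ} → (Fin n → Measure ℝ) → (Fin T → Fin n → ℝ) → ℝ
  | 0, _, _ => 0
  | _ + 1, D, S => compensator (Fin.tail D) (fun t => Fin.tail (S t)) +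
      ((∫ x, max (dpReward (Fin.tail (empirical S))) x ∂(D 0)) -
        dpReward (Fin.tail (empirical S)))

/-- The martingale part of the empirical rewards. -/
noncomputable def deviation {n T : ℕ} (D : Fin n → Measure ℝ) (S : Fin T → Fin n → ℝ) : ℝ :=
  dpReward (empirical S) - compensator D S

/-- The exponential supermartingale that controls `deviation`. -/
noncomputable def expDeviation (l : ℝ) {n T : ℕ} (D : Fin n → Measure ℝ)
    (S : Fin T → Fin n → ℝ) : ℝ :=
  Real.exp (l * deviation D S - compensator D S)

/-- The process `expDeviation`, stopped when it reaches the level `c`. -/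
noncomputable def stoppedExpDeviation (l c : ℝ) {T : ℕ} :
    {n : ℕ} → (Fin n → Measure ℝ) → (Fin T → Fin n → ℝ) → ℝ
  | 0, _, _ => 1
  | _ + 1, D, S =>
      if c ≤ stoppedExpDeviation l c (Fin.tail D) (fun t => Fin.tail (S t)) then
        stoppedExpDeviation l c (Fin.tail D) (fun t => Fin.tail (S t))
      else expDeviation l D S

/-- All the partial sums of the martingale are at most `a` in absolute value. -/
def DeviationLE (a : ℝ) {T : ℕ} : {n : ℕ} → (Fin n → Measure ℝ) → (Fin T → Fin n → ℝ) → Prop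
  | 0, _, _ => True
  | _ + 1, D, S => |deviation D S| ≤ a ∧ DeviationLE a (Fin.tail D) (fun t => Fin.tail (S t))

theorem deviation_zero {T : ℕ} (D : Fin 0 → Measure ℝ) (S : Fin T → Fin 0 → ℝ) :
    deviation D S = 0 := by
  simp [deviation, compensator, dpReward]

theorem deviation_succ {n T : ℕ} (D : Fin (n + 1) → Measure ℝ) (S : Fin T → Fin (n + 1) → ℝ) :
    deviation D S = dpReward (empirical S) +
      deviation (Fin.tail D) (fun t => Fin.tail (S t)) -
      ∫ x, max (dpReward (empirical fun t => Fin.tail (S t))) x ∂(D 0) := by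
  have h : Fin.tail (empirical S) = empirical fun t => Fin.tail (S t) := rfl
  simp only [deviation, compensator, h]
  ring

theorem DeviationLE.abs_le {n T : ℕ} {a : ℝ} (ha : 0 ≤ a) {D : Fin n → Measure ℝ}
    {S : Fin T → Fin n → ℝ} (h : DeviationLE a D S) : |deviation D S| ≤ a := by
  cases n with
  | zero => simpa [deviation_zero] using ha
  | succ n => exact h.1

/-! ### Deterministic error bounds on the event of small deviations. -/

/-- The slack `a - M` of the later buyers is nonnegative, so it can be pulled out of the maximum;
the recursion `deviation_succ` then turns it into the slack for all buyers. Keeping `M` in the bound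
makes the errors telescope. -/
theorem dpReward_sub_le {n T : ℕ} {a : ℝ} (ha : 0 ≤ a) (D : Fin n → Measure ℝ)
    [∀ i, IsProbabilityMeasure (D i)] (hD : ∀ i, ∀ᵐ x ∂(D i), x ∈ Set.Icc (0 : ℝ) 1)
    (S : Fin T → Fin n → ℝ) (h : DeviationLE a D S) :
    dpReward D - dpReward (empirical S) ≤ a - deviation D S := by
  induction n with
  | zero => simpa [deviation_zero, dpReward] using ha
  | succ n ih =>
    have h1 := ih (Fin.tail D) (fun i => hD i.succ) (fun t => Fin.tail (S t)) h.2
    have h2 := (abs_le.1 (h.2.abs_le ha)).2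
    have h3 : dpReward D ≤
        ∫ x, (max (dpReward (empirical fun t => Fin.tail (S t))) x +
          (a - deviation (Fin.tail D) fun t => Fin.tail (S t))) ∂(D 0) := by
      refine integral_mono (integrable_max (hD 0) _)
        ((integrable_max (hD 0) _).add (integrable_const _)) fun x => max_le ?_ ?_
      · linarith [le_max_left (dpReward (empirical fun t => Fin.tail (S t))) x]
      · linarith [le_max_right (dpReward (empirical fun t => Fin.tail (S t))) x]
    rw [integral_add (integrable_max (hD 0) _) (integrable_const _), integral_const] at h3
    simp only [probReal_univ, one_smul] at h3
    rw [deviation_succ]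
    linarith

/-- The same telescoping with the opposite sign. If the first buyer accepts, nothing is lost, and `a
+ M ≥ 0` for the later buyers covers this case. -/
theorem dpReward_empirical_sub_le {n T : ℕ} {a : ℝ} (ha : 0 ≤ a) (D : Fin n → Measure ℝ)
    [∀ i, IsProbabilityMeasure (D i)] (hD : ∀ i, ∀ᵐ x ∂(D i), x ∈ Set.Icc (0 : ℝ) 1)
    (S : Fin T → Fin n → ℝ) (h : DeviationLE a D S) :
    dpReward (empirical S) - expectedWelfare (dpPolicy (empirical S)) (Measure.pi D) ≤
      a + deviation D S := by
  induction n with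
  | zero => simpa [deviation_zero, dpReward, expectedWelfare, welfare] using ha
  | succ n ih =>
    have h1 := ih (Fin.tail D) (fun i => hD i.succ) (fun t => Fin.tail (S t)) h.2
    have h2 := (abs_le.1 (h.2.abs_le ha)).1
    have ht : Fin.tail (empirical S) = empirical fun t => Fin.tail (S t) := rfl
    set r := dpReward (empirical fun t => Fin.tail (S t)) with hr
    have h3 : ∫ x, max r x ∂(D 0) ≤
        ∫ x, ((if r ≤ x then x else expectedWelfare (dpPolicy (empirical fun t => Fin.tail (S t)))
          (Measure.pi (Fin.tail D))) +
          (a + deviation (Fin.tail D) fun t => Fin.tail (S t))) ∂(D 0) := by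
      refine integral_mono (integrable_max (hD 0) _)
        ((integrable_ite (hD 0) _ _).add (integrable_const _)) fun x => ?_
      dsimp only
      split_ifs with hx
      · rw [max_eq_right hx]
        linarith
      · rw [max_eq_left (not_le.1 hx).le]
        linarith
    rw [integral_add (integrable_ite (hD 0) _ _) (integrable_const _), integral_const] at h3
    simp only [probReal_univ, one_smul] at h3
    rw [deviation_succ, expectedWelfare_succ D hD]
    simp only [dpPolicy, Fin.cons_zero, Fin.tail_cons, ht, ← hr]
    linarith

theorem isApprox_of_deviationLE {n T : ℕ} (hT : 0 < T) {ε : ℝ} (hε : 0 ≤ ε)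
    (D : Fin n → Measure ℝ) [∀ i, IsProbabilityMeasure (D i)]
    (hD : ∀ i, ∀ᵐ x ∂(D i), x ∈ Set.Icc (0 : ℝ) 1) (S : Fin T → Fin n → ℝ)
    (hS : ∀ t i, S t i ∈ Set.Icc (0 : ℝ) 1) (h : DeviationLE (ε / 2) D S) :
    IsApprox (Measure.pi D) ε (dpPolicy (empirical S)) := by
  have := isProbabilityMeasure_empirical hT S
  refine ⟨dpPolicy_mem_policies _ fun i => ae_empirical measurableSet_Icc fun t => hS t i, ?_⟩
  rw [optWelfare_pi D hD]
  have h1 := dpReward_sub_le (by positivity) D hD S h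
  have h2 := dpReward_empirical_sub_le (by positivity) D hD S h
  linarith

/-! ### From the stopped exponential processes to small deviations. -/

theorem stoppedExpDeviation_eq {n T : ℕ} {l c : ℝ} {D : Fin n → Measure ℝ}
    {S : Fin T → Fin n → ℝ} (h : stoppedExpDeviation l c D S < c) :
    stoppedExpDeviation l c D S = expDeviation l D S := by
  cases n with
  | zero => simp [stoppedExpDeviation, expDeviation, deviation_zero, compensator]
  | succ n =>
    rw [stoppedExpDeviation] at h ⊢
    split_ifs at h ⊢ with hc
    · exact absurd hc h.not_ge
    · rfl

theorem stoppedExpDeviation_tail_lt {n T : ℕ} {l c : ℝ} {D : Fin (n + 1) → Measure ℝ}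
    {S : Fin T → Fin (n + 1) → ℝ} (h : stoppedExpDeviation l c D S < c) :
    stoppedExpDeviation l c (Fin.tail D) (fun t => Fin.tail (S t)) < c := by
  rw [stoppedExpDeviation] at h
  split_ifs at h with hc
  · exact h
  · exact not_le.1 hc

theorem deviationLE_of_stoppedExpDeviation_lt {n T : ℕ} (hT : 0 < T) {ε L c : ℝ} (hε : 0 < ε)
    (hε1 : ε < 1) (hL : 1 ≤ L) (hc : c ≤ Real.exp (L - 1)) (hTL : 5 * L ≤ ε * √(T : ℝ))
    (D : Fin n → Measure ℝ) (S : Fin T → Fin n → ℝ) (hS : ∀ t i, S t i ∈ Set.Icc (0 : ℝ) 1)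
    (hpos : stoppedExpDeviation (√T) c D S < c) (hneg : stoppedExpDeviation (-√T) c D S < c) :
    DeviationLE (ε / 2) D S := by
  induction n with
  | zero => trivial
  | succ n ih =>
    refine ⟨?_, ih _ _ (fun t i => hS t i.succ) (stoppedExpDeviation_tail_lt hpos)
      (stoppedExpDeviation_tail_lt hneg)⟩
    have hr : dpReward (empirical S) ≤ 1 := by
      have := isProbabilityMeasure_empirical hT S
      exact dpReward_le_one _ fun i => ae_empirical measurableSet_Icc fun t => hS t i
    rw [stoppedExpDeviation_eq hpos] at hpos
    rw [stoppedExpDeviation_eq hneg] at hneg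
    have h1 := Real.exp_lt_exp.1 (hpos.trans_le hc)
    have h2 := Real.exp_lt_exp.1 (hneg.trans_le hc)
    -- Self-bounding: the accumulated variance is controlled by the reward, which never exceeds 1.
    have hC : compensator D S ≤ 1 - deviation D S := by
      rw [deviation]
      linarith
    have hs : 5 ≤ √(T : ℝ) := by nlinarith [Real.sqrt_nonneg (T : ℝ)]
    -- The two levels give `(√T + 1) M < L` and `-(√T - 1) M < L`, while `(√T - 1) ε / 2 ≥ (5 L - 1)
    -- / 2 ≥ 2 L`.
    refine abs_le.2 ⟨?_, ?_⟩ <;> by_contra! h3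
    · nlinarith
    · nlinarith

/-! ### Separating the first buyer's samples, and measurability. -/

theorem measurePreserving_splitFirst {n : ℕ} (D : Fin (n + 1) → Measure ℝ)
    [∀ i, IsProbabilityMeasure (D i)] (T : ℕ) :
    MeasurePreserving (fun S : Fin T → Fin (n + 1) → ℝ =>
        ((fun t => S t 0 : Fin T → ℝ), fun t => Fin.tail (S t)))
      (sampleLaw D T) ((Measure.pi fun _ => D 0).prod (sampleLaw (Fin.tail D) T)) :=
  (measurePreserving_arrowProdEquivProdArrow ℝ (Fin n → ℝ) (Fin T) (fun _ => D 0)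
    (fun _ => Measure.pi (Fin.tail D))).comp
    (measurePreserving_pi (fun _ => Measure.pi D)
      (fun _ => (D 0).prod (Measure.pi (Fin.tail D)))
      fun _ => measurePreserving_piFinSuccAbove D 0)

theorem measurable_cons {n T : ℕ} : Measurable
    fun (q : (Fin T → ℝ) × (Fin T → Fin n → ℝ)) (t : Fin T) =>
      (Fin.cons (q.1 t) (q.2 t) : Fin (n + 1) → ℝ) := by
  refine measurable_pi_lambda _ fun t => measurable_pi_lambda _ fun i => ?_
  refine Fin.cases ?_ (fun i => ?_) i
  · simp only [Fin.cons_zero]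
    fun_prop
  · simp only [Fin.cons_succ]
    fun_prop

theorem measurable_tail {n T : ℕ} :
    Measurable fun (S : Fin T → Fin (n + 1) → ℝ) (t : Fin T) => Fin.tail (S t) := by
  unfold Fin.tail
  fun_prop

theorem lintegral_sampleLaw_succ {n T : ℕ} (D : Fin (n + 1) → Measure ℝ)
    [∀ i, IsProbabilityMeasure (D i)] {f : (Fin T → Fin (n + 1) → ℝ) → ℝ≥0∞}
    (hf : Measurable f) :
    ∫⁻ S, f S ∂(sampleLaw D T) = ∫⁻ S, ∫⁻ x : Fin T → ℝ, f (fun t => Fin.cons (x t) (S t))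
      ∂(Measure.pi fun _ => D 0) ∂(sampleLaw (Fin.tail D) T) := by
  have : SFinite (sampleLaw (Fin.tail D) T) := by
    unfold sampleLaw
    infer_instance
  have h := (measurePreserving_splitFirst D T).lintegral_comp (hf.comp measurable_cons)
  rw [lintegral_prod_symm _ (hf.comp measurable_cons).aemeasurable] at h
  refine Eq.trans ?_ h
  refine lintegral_congr fun S => ?_
  simp only [Function.comp_apply]
  congr 1
  funext t
  exact (Fin.cons_self_tail (S t)).symm

theorem dpReward_empirical_succ {n T : ℕ} (S : Fin T → Fin (n + 1) → ℝ) :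
    dpReward (empirical S) =
      (T : ℝ)⁻¹ * ∑ t, max (dpReward (empirical fun t => Fin.tail (S t))) (S t 0) :=
  integral_empirical S 0

theorem measurable_dpReward_empirical {n T : ℕ} :
    Measurable fun S : Fin T → Fin n → ℝ => dpReward (empirical S) := by
  induction n with
  | zero => exact measurable_const
  | succ n ih =>
    simp_rw [dpReward_empirical_succ]
    have := ih.comp (measurable_tail (n := n) (T := T))
    refine (Finset.measurable_sum _ fun t _ => ?_).const_mul _
    exact this.max (by fun_prop)

theorem measurable_dpPolicy_empirical {n T : ℕ} :
    Measurable fun S : Fin T → Fin n → ℝ => dpPolicy (empirical S) := by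
  induction n with
  | zero => exact measurable_const
  | succ n ih =>
    refine measurable_pi_lambda _ fun i => ?_
    refine Fin.cases ?_ (fun i => ?_) i
    · exact measurable_dpReward_empirical.comp measurable_tail
    · exact (measurable_pi_apply i).comp (ih.comp measurable_tail)

theorem measurable_compensator {n T : ℕ} (D : Fin n → Measure ℝ)
    [∀ i, IsProbabilityMeasure (D i)] :
    Measurable fun S : Fin T → Fin n → ℝ => compensator D S := by
  induction n with
  | zero => exact measurable_const
  | succ n ih =>
    have h : Measurable fun S : Fin T → Fin (n + 1) → ℝ => dpReward (Fin.tail (empirical S)) :=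
      measurable_dpReward_empirical.comp measurable_tail
    refine ((ih (Fin.tail D)).comp measurable_tail).add (Measurable.sub ?_ h)
    have h2 : Measurable fun q : (Fin T → Fin (n + 1) → ℝ) × ℝ =>
        max (dpReward (Fin.tail (empirical q.1))) q.2 :=
      (h.comp measurable_fst).max measurable_snd
    exact h2.stronglyMeasurable.integral_prod_right'.measurable

theorem measurable_stoppedExpDeviation {n T : ℕ} (l c : ℝ) (D : Fin n → Measure ℝ)
    [∀ i, IsProbabilityMeasure (D i)] :
    Measurable fun S : Fin T → Fin n → ℝ => stoppedExpDeviation l c D S := by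
  induction n with
  | zero => exact measurable_const
  | succ n ih =>
    have h := (ih (Fin.tail D)).comp (measurable_tail (n := n) (T := T))
    refine Measurable.ite (measurableSet_le measurable_const h) h ?_
    exact (((measurable_dpReward_empirical.sub (measurable_compensator D)).const_mul l).sub
      (measurable_compensator D)).exp

/-! ### Exponential moments and the supermartingale property. -/

theorem exp_mul_le_one_add {s y : ℝ} (hy : y ∈ Set.Icc (0 : ℝ) 1) :
    Real.exp (s * y) ≤ 1 + y * (Real.exp s - 1) := by
  have h := convexOn_exp.2 (Set.mem_univ 0) (Set.mem_univ s) (sub_nonneg.2 hy.2) hy.1 (by ring)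
  simp only [smul_eq_mul, mul_zero, zero_add, Real.exp_zero, mul_one] at h
  rw [mul_comm]
  linarith

theorem integrable_exp_max {μ : Measure ℝ} [IsProbabilityMeasure μ]
    (hμ : ∀ᵐ x ∂μ, x ∈ Set.Icc (0 : ℝ) 1) (r s m : ℝ) :
    Integrable (fun x => Real.exp (s * (max r x - m))) μ := by
  refine Integrable.of_mem_Icc 0 (Real.exp (|s| * (max |r| 1 + |m|))) (by fun_prop)
    (hμ.mono fun x hx => ⟨(Real.exp_pos _).le, Real.exp_le_exp.2 ?_⟩)
  refine (le_abs_self _).trans ?_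
  rw [abs_mul]
  refine mul_le_mul_of_nonneg_left ((abs_sub _ _).trans (add_le_add_left ?_ _)) (abs_nonneg _)
  refine abs_max_le_max_abs_abs.trans (max_le_max le_rfl ?_)
  exact abs_le.2 ⟨by linarith [hx.1], hx.2⟩

/-- A moment generating function bound in terms of the mean of the excess of the value over `r`. -/
theorem integral_exp_max_le {μ : Measure ℝ} [IsProbabilityMeasure μ]
    (hμ : ∀ᵐ x ∂μ, x ∈ Set.Icc (0 : ℝ) 1) {r s : ℝ} (hr : 0 ≤ r) (hs : |s| ≤ 1) :
    ∫ x, Real.exp (s * (max r x - ∫ y, max r y ∂μ)) ∂μ ≤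
      Real.exp (s ^ 2 * ((∫ y, max r y ∂μ) - r)) := by
  set m := ∫ y, max r y ∂μ with hm
  have hi := integrable_max hμ r
  have hi2 : Integrable (fun x => (max r x - r) * (Real.exp s - 1)) μ :=
    (hi.sub (integrable_const r)).mul_const _
  have hrm : r ≤ m := by
    have := integral_mono (integrable_const r) hi fun x => le_max_left r x
    simpa using this
  have h1 : ∫ x, Real.exp (s * (max r x - m)) ∂μ ≤
      ∫ x, Real.exp (s * (r - m)) * (1 + (max r x - r) * (Real.exp s - 1)) ∂μ := by
    refine integral_mono_ae (integrable_exp_max hμ r s m)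
      (((integrable_const 1).add hi2).const_mul _)
      (hμ.mono fun x hx => ?_)
    have hy : max r x - r ∈ Set.Icc (0 : ℝ) 1 :=
      ⟨sub_nonneg.2 (le_max_left _ _), by
        rw [sub_le_iff_le_add]
        exact max_le (by linarith) (by linarith [hx.2])⟩
    calc Real.exp (s * (max r x - m))
        = Real.exp (s * (r - m)) * Real.exp (s * (max r x - r)) := by
          rw [← Real.exp_add]
          ring_nf
      _ ≤ _ := mul_le_mul_of_nonneg_left (exp_mul_le_one_add hy) (Real.exp_pos _).le
  refine h1.trans ?_
  rw [integral_const_mul, integral_add (integrable_const _) hi2, integral_mul_const,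
    integral_sub hi (integrable_const r), ← hm]
  simp only [integral_const, probReal_univ, one_smul]
  have h2 := Real.add_one_le_exp ((m - r) * (Real.exp s - 1))
  -- `exp s - 1 - s ≤ s ^ 2` for `|s| ≤ 1` produces the quadratic exponent.
  have h3 := (abs_le.1 (Real.abs_exp_sub_one_sub_id_le hs)).2
  calc Real.exp (s * (r - m)) * (1 + (m - r) * (Real.exp s - 1))
      ≤ Real.exp (s * (r - m)) * Real.exp ((m - r) * (Real.exp s - 1)) :=
        mul_le_mul_of_nonneg_left (by linarith) (Real.exp_pos _).le
    _ = Real.exp ((m - r) * (Real.exp s - 1 - s)) := by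
        rw [← Real.exp_add]
        ring_nf
    _ ≤ Real.exp (s ^ 2 * (m - r)) :=
        Real.exp_le_exp.2 (by nlinarith)

/-- The exponential factors over the samples with parameter `s = l / T`. The choice `l ^ 2 = T`
makes `T * s ^ 2 = 1`, so the exponent is exactly one increment of the compensator; both signs of
`l` are allowed. -/
theorem lintegral_exp_mean_le {μ : Measure ℝ} [IsProbabilityMeasure μ]
    (hμ : ∀ᵐ x ∂μ, x ∈ Set.Icc (0 : ℝ) 1) {T : ℕ} (hT : 0 < T) {l r : ℝ} (hl : l ^ 2 = T)
    (hr : 0 ≤ r) :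
    ∫⁻ x : Fin T → ℝ, ENNReal.ofReal (Real.exp
        (l * ((T : ℝ)⁻¹ * ∑ t, max r (x t) - ∫ y, max r y ∂μ))) ∂(Measure.pi fun _ => μ) ≤
      ENNReal.ofReal (Real.exp ((∫ y, max r y ∂μ) - r)) := by
  set m := ∫ y, max r y ∂μ with hm
  have hT1 : (1 : ℝ) ≤ T := by exact_mod_cast hT
  have hs2 : (l / T) ^ 2 = (T : ℝ)⁻¹ := by
    rw [div_pow, hl]
    field_simp
  have hs : |l / T| ≤ 1 := by
    rw [← sq_le_one_iff_abs_le_one, hs2]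
    exact inv_le_one_of_one_le₀ hT1
  have he : ∀ x : Fin T → ℝ, Real.exp (l * ((T : ℝ)⁻¹ * ∑ t, max r (x t) - m)) =
      ∏ t, Real.exp (l / T * (max r (x t) - m)) := by
    intro x
    rw [← Real.exp_sum, ← Finset.mul_sum, Finset.sum_sub_distrib]
    congr 1
    simp only [Finset.sum_const, Finset.card_univ, Fintype.card_fin, nsmul_eq_mul]
    field_simp
  simp_rw [he]
  have hint : Integrable (fun x : Fin T → ℝ => ∏ t, Real.exp (l / T * (max r (x t) - m)))
      (Measure.pi fun _ => μ) :=
    Integrable.fintype_prod (f := fun (_ : Fin T) y => Real.exp (l / T * (max r y - m)))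
      fun _ => integrable_exp_max hμ r _ m
  rw [← ofReal_integral_eq_lintegral_ofReal hint
    (Filter.Eventually.of_forall fun x => Finset.prod_nonneg fun _ _ => (Real.exp_pos _).le)]
  refine ENNReal.ofReal_le_ofReal ?_
  rw [integral_fintype_prod_eq_prod (fun (_ : Fin T) y => Real.exp (l / T * (max r y - m)))]
  simp only [Finset.prod_const, Finset.card_univ, Fintype.card_fin]
  refine (pow_le_pow_left₀ (integral_nonneg fun _ => (Real.exp_pos _).le)
    (integral_exp_max_le hμ hr hs) T).trans ?_
  rw [hs2, ← Real.exp_nat_mul, ← hm, mul_inv_cancel_left₀ (by positivity)]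

theorem lintegral_stoppedExpDeviation_le {n T : ℕ} (hT : 0 < T) {l : ℝ} (hl : l ^ 2 = T) (c : ℝ)
    (D : Fin n → Measure ℝ) [∀ i, IsProbabilityMeasure (D i)]
    (hD : ∀ i, ∀ᵐ x ∂(D i), x ∈ Set.Icc (0 : ℝ) 1) :
    ∫⁻ S, ENNReal.ofReal (stoppedExpDeviation l c D S) ∂(sampleLaw D T) ≤ 1 := by
  induction n with
  | zero =>
    have : IsProbabilityMeasure (sampleLaw D T) := by
      unfold sampleLaw
      infer_instance
    simp [stoppedExpDeviation]
  | succ n ih =>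
    rw [lintegral_sampleLaw_succ D (measurable_stoppedExpDeviation l c D).ennreal_ofReal]
    refine (lintegral_mono fun S => ?_).trans (ih (Fin.tail D) fun i => hD i.succ)
    simp only [stoppedExpDeviation, Fin.tail_cons]
    split_ifs with h
    -- Already stopped: the integrand is constant in the first buyer's samples.
    · simp
    rw [stoppedExpDeviation_eq (not_le.1 h)]
    set r := dpReward (empirical S) with hr
    set m := ∫ y, max r y ∂(D 0) with hm
    have hp : 0 ≤ Real.exp (r - m) * expDeviation l (Fin.tail D) S := by
      unfold expDeviation
      positivity
    have he : ∀ x : Fin T → ℝ,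
        ENNReal.ofReal (expDeviation l D fun t => Fin.cons (x t) (S t)) =
        ENNReal.ofReal (Real.exp (r - m) * expDeviation l (Fin.tail D) S) *
          ENNReal.ofReal (Real.exp (l * ((T : ℝ)⁻¹ * ∑ t, max r (x t) - m))) := by
      intro x
      rw [← ENNReal.ofReal_mul hp]
      congr 1
      have ht : Fin.tail (empirical fun t => (Fin.cons (x t) (S t) : Fin (n + 1) → ℝ)) =
        empirical S := rfl
      simp only [expDeviation, ← Real.exp_add, deviation_succ, dpReward_empirical_succ,
        Fin.tail_cons, Fin.cons_zero, compensator, ht, ← hr, ← hm]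
      congr 1
      ring
    simp_rw [he]
    rw [lintegral_const_mul _ (by fun_prop)]
    -- The moment bound `exp (m - r)` cancels the compensator factor `exp (r - m)`.
    refine (mul_le_mul_right (lintegral_exp_mean_le (hD 0) hT hl (dpReward_nonneg _)) _).trans ?_
    rw [← ENNReal.ofReal_mul hp, ← hr, ← hm,
      mul_right_comm, ← Real.exp_add]
    simp

/-- A maximal inequality: the stopped process ends at level `c` or above exactly when it reached `c`
at some buyer, so Markov's inequality for its final value suffices. -/
theorem sampleLaw_le_stoppedExpDeviation {n T : ℕ} (hT : 0 < T) {l c : ℝ} (hl : l ^ 2 = T)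
    (hc : 0 < c) (D : Fin n → Measure ℝ) [∀ i, IsProbabilityMeasure (D i)]
    (hD : ∀ i, ∀ᵐ x ∂(D i), x ∈ Set.Icc (0 : ℝ) 1) :
    sampleLaw D T {S | c ≤ stoppedExpDeviation l c D S} ≤ ENNReal.ofReal c⁻¹ := by
  have h := meas_ge_le_lintegral_div (μ := sampleLaw D T)
    (measurable_stoppedExpDeviation l c D).ennreal_ofReal.aemeasurable
    (ε := ENNReal.ofReal c) (by simpa using hc) ENNReal.ofReal_ne_top
  refine (measure_mono fun S hS => ENNReal.ofReal_le_ofReal hS).trans (h.trans ?_)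
  rw [ENNReal.ofReal_inv_of_pos hc, ENNReal.div_eq_inv_mul]
  exact mul_le_of_le_one_right' (lintegral_stoppedExpDeviation_le hT hl c D hD)

theorem sampleLaw_not_isApprox_le {n T : ℕ} {ε δ : ℝ} (hε : 0 < ε) (hε1 : ε < 1) (hδ : 0 < δ)
    (hδ1 : δ < 1) (hT : (5 * Real.log (2 * Real.exp 1 / δ) / ε) ^ 2 ≤ (T : ℝ))
    (D : Fin n → Measure ℝ) [∀ i, IsProbabilityMeasure (D i)]
    (hD : ∀ i, ∀ᵐ x ∂(D i), x ∈ Set.Icc (0 : ℝ) 1) :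
    sampleLaw D T {S | ¬ IsApprox (Measure.pi D) ε (dpPolicy (empirical S))} ≤
      ENNReal.ofReal δ := by
  set L := Real.log (2 * Real.exp 1 / δ) with hL
  have hLe : Real.exp L = 2 * Real.exp 1 / δ := Real.exp_log (by positivity)
  -- Level `2 / δ` leaves `δ / 2` for each sign; the factor `e` in `2e/δ` pays for the 1 in `C ≤ 1 -
  -- M`.
  have hc : 2 / δ = Real.exp (L - 1) := by
    rw [Real.exp_sub, hLe]
    field_simp
  have hL1 : 1 ≤ L := by
    rw [← sub_nonneg, ← Real.one_le_exp_iff, ← hc, one_le_div hδ]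
    linarith
  have hTpos : 0 < T := by
    have : (0 : ℝ) < T := lt_of_lt_of_le (by positivity) hT
    exact_mod_cast this
  have hTL : 5 * L ≤ ε * √(T : ℝ) := by
    have := Real.le_sqrt_of_sq_le hT
    rw [div_le_iff₀ hε] at this
    linarith
  have hsq : √(T : ℝ) ^ 2 = T := Real.sq_sqrt (Nat.cast_nonneg T)
  have hbad : {S : Fin T → Fin n → ℝ | ¬ IsApprox (Measure.pi D) ε (dpPolicy (empirical S))} ≤ᵐ[
      sampleLaw D T] ({S | 2 / δ ≤ stoppedExpDeviation (√T) (2 / δ) D S} ∪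
        {S | 2 / δ ≤ stoppedExpDeviation (-√T) (2 / δ) D S} : Set _) := by
    have hcube : ∀ᵐ S ∂(sampleLaw D T), ∀ t i, S t i ∈ Set.Icc (0 : ℝ) 1 :=
      ae_pi_mem (fun _ => Measure.pi D) (p := fun _ v => ∀ i, v i ∈ Set.Icc (0 : ℝ) 1)
        fun _ => ae_pi_mem D hD
    filter_upwards [hcube] with S hS hS1
    by_contra h
    obtain ⟨h1, h2⟩ := not_or.1 h
    exact hS1 (isApprox_of_deviationLE hTpos hε.le D hD S hS
      (deviationLE_of_stoppedExpDeviation_lt hTpos hε hε1 hL1 hc.le hTL D S hS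
        (not_le.1 h1) (not_le.1 h2)))
  refine (measure_mono_ae hbad).trans ((measure_union_le _ _).trans ?_)
  have hδ2 : 0 < 2 / δ := by positivity
  refine (add_le_add (sampleLaw_le_stoppedExpDeviation hTpos hsq hδ2 D hD)
    (sampleLaw_le_stoppedExpDeviation hTpos (by rw [neg_sq, hsq]) hδ2 D hD)).trans ?_
  rw [← ENNReal.ofReal_add (by positivity) (by positivity), inv_div, add_halves]

/-! ### Sample complexity. -/

theorem measurableSet_isApprox {n : ℕ} (μ : Measure (Fin n → ℝ)) [SFinite μ] (ε : ℝ) :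
    MeasurableSet {π | IsApprox μ ε π} := by
  have h1 : MeasurableSet (policies n) := by
    simp only [policies, Set.ofPred_forall]
    exact MeasurableSet.iInter fun i => measurableSet_Icc.preimage (measurable_pi_apply i)
  have h2 : Measurable fun π : Fin n → ℝ => expectedWelfare π μ :=
    measurable_welfare.stronglyMeasurable.integral_prod_right'.measurable
  exact h1.inter (measurableSet_le measurable_const h2)

theorem sampleComplexity_le {n T : ℕ} {ε δ : ℝ} (hε : 0 < ε) (hε1 : ε < 1) (hδ : 0 < δ)
    (hδ1 : δ < 1) (hT : (5 * Real.log (2 * Real.exp 1 / δ) / ε) ^ 2 ≤ (T : ℝ)) :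
    sampleComplexity n ε δ ≤ T := by
  refine sInf_le ⟨T, rfl, Kernel.deterministic _ measurable_dpPolicy_empirical, inferInstance, ?_⟩
  intro D _ hD
  have hm : MeasurableSet {π | ¬ IsApprox (Measure.pi D) ε π} := (measurableSet_isApprox _ ε).compl
  rw [Measure.deterministic_comp_eq_map, Measure.map_apply measurable_dpPolicy_empirical hm]
  exact sampleLaw_not_isApprox_le hε hε1 hδ hδ1 hT D hD

theorem exists_sampleComplexity_le {δ₀ : ℝ} (hδ₀ : δ₀ < 1) :
    ∃ C : ℝ, 0 < C ∧ ∀ (n : ℕ) (ε δ : ℝ), 0 < ε → ε < 1 → 0 < δ → δ ≤ δ₀ →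
      (sampleComplexity n ε δ : ℝ≥0∞) ≤
        ENNReal.ofReal (C * (Real.log (1 / δ)) ^ 2 / ε ^ 2) := by
  rcases le_or_gt δ₀ 0 with h0 | h0
  · exact ⟨1, one_pos, fun n ε δ _ _ h h' => absurd (h.trans_le h') h0.not_gt⟩
  have hl0 : 0 < Real.log (1 / δ₀) := Real.log_pos ((one_lt_div h0).2 hδ₀)
  have hb : 0 < Real.log 2 + 1 := by positivity
  -- `K` absorbs the additive `log 2 + 1` into a multiple of `log (1/δ)`, which is bounded away from
  -- 0 since `δ ≤ δ₀ < 1`. In the constant, `26 = 5 ^ 2 + 1`, the last 1 for rounding `T` up.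
  set K := 1 + (Real.log 2 + 1) / Real.log (1 / δ₀) with hK
  refine ⟨26 * K ^ 2, by positivity, fun n ε δ hε hε1 hδ hδδ => ?_⟩
  have hll : Real.log (1 / δ₀) ≤ Real.log (1 / δ) :=
    Real.log_le_log (by positivity) (one_div_le_one_div_of_le hδ hδδ)
  set l := Real.log (1 / δ) with hl
  set L := Real.log (2 * Real.exp 1 / δ) with hL
  have hLl : L = Real.log 2 + 1 + l := by
    rw [hL, hl, mul_div_assoc, Real.log_mul (by norm_num) (by positivity), div_eq_mul_one_div,
      Real.log_mul (by positivity) (by positivity), Real.log_exp, add_assoc]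
  have hLK : L ≤ K * l := by
    have : Real.log 2 + 1 ≤ (Real.log 2 + 1) / Real.log (1 / δ₀) * l := by
      rw [div_mul_eq_mul_div, le_div_iff₀ hl0]
      exact mul_le_mul_of_nonneg_left hll hb.le
    rw [hK, hLl]
    linarith
  have hL1 : 1 ≤ L := by
    have := Real.log_pos (one_lt_two : (1 : ℝ) < 2)
    linarith
  have h1 : 1 ≤ L ^ 2 / ε ^ 2 := by
    rw [one_le_div (by positivity)]
    exact pow_le_pow_left₀ hε.le (by linarith) 2
  have h2 := sampleComplexity_le (n := n) hε hε1 hδ (hδδ.trans_lt hδ₀) (Nat.le_ceil _)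
  refine (ENat.toENNReal_le.2 h2).trans ?_
  rw [ENat.toENNReal_coe, ← ENNReal.ofReal_natCast]
  refine ENNReal.ofReal_le_ofReal ((Nat.ceil_lt_add_one (sq_nonneg _)).le.trans ?_)
  calc (5 * L / ε) ^ 2 + 1 ≤ 25 * (L ^ 2 / ε ^ 2) + L ^ 2 / ε ^ 2 := by
        refine add_le_add (le_of_eq ?_) h1
        ring
    _ = 26 * (L ^ 2 / ε ^ 2) := by ring
    _ ≤ 26 * ((K * l) ^ 2 / ε ^ 2) := by gcongr
    _ = 26 * K ^ 2 * l ^ 2 / ε ^ 2 := by ring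

end PostedPricing

theorem theorem1 :
    -- the sample complexity is `O(log²(1/δ)/ε²)`, uniformly in the number of buyers
    (∀ δ₀ : ℝ, δ₀ < 1 → ∃ C : ℝ, 0 < C ∧ ∀ (n : ℕ) (ε δ : ℝ), 0 < ε → ε < 1 → 0 < δ → δ ≤ δ₀ →
      (sampleComplexity n ε δ : ℝ≥0∞) ≤ ENNReal.ofReal (C * (Real.log (1 / δ)) ^ 2 / ε ^ 2)) ∧
    -- the dynamic program on the product empirical distribution is optimal for that distribution
    (∀ (n T : ℕ) (S : Fin T → Fin n → ℝ), 0 < T → (∀ t i, S t i ∈ Set.Icc (0 : ℝ) 1) →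
      dpPolicy (empirical S) ∈ policies n ∧
      expectedWelfare (dpPolicy (empirical S)) (Measure.pi (empirical S)) =
        optWelfare (Measure.pi (empirical S))) ∧
    -- with `T ≥ (5 ln(2e/δ)/ε)²` samples it fails to be an `ε`-approximation with
    -- probability at most `δ`
    (∀ (n T : ℕ) (ε δ : ℝ), 0 < ε → ε < 1 → 0 < δ → δ < 1 →
      (5 * Real.log (2 * Real.exp 1 / δ) / ε) ^ 2 ≤ (T : ℝ) →
      ∀ (D : Fin n → Measure ℝ) [∀ i, IsProbabilityMeasure (D i)],
        (∀ i, ∀ᵐ x ∂(D i), x ∈ Set.Icc (0 : ℝ) 1) →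
        sampleLaw D T {S | ¬ IsApprox (Measure.pi D) ε (dpPolicy (empirical S))} ≤
          ENNReal.ofReal δ) := by
  refine ⟨fun δ₀ h => exists_sampleComplexity_le h, fun n T S hT hS => ?_,
    fun n T ε δ hε hε1 hδ hδ1 hT D _ hD => sampleLaw_not_isApprox_le hε hε1 hδ hδ1 hT D hD⟩
  have := isProbabilityMeasure_empirical hT S
  have hD : ∀ i, ∀ᵐ x ∂(empirical S i), x ∈ Set.Icc (0 : ℝ) 1 :=
    fun i => ae_empirical measurableSet_Icc fun t => hS t i
  exact ⟨dpPolicy_mem_policies _ hD, by rw [expectedWelfare_dpPolicy _ hD, optWelfare_pi _ hD]⟩
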